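/- A random walk on $\mathbb N^2$ (where $\mathbb N=\{0,1,2,\dots\}$) is a time-homogeneous Markov chain $X$ on $\mathbb N^2$ that at each step moves from its current state to the state immediately to the right, to the left, above or below (i.e. adds $(1,0)$, $(-1,0)$, $(0,1)$ or $(0,-1)$), with probabilities $r_X(p)$, $\ell_X(p)$, $u_X(p)$, $d_X(p)$ that may depend on the state $p$, are non-negative and sum to $1$, moves out of $\mathbb N^2$ having probability $0$. It is irreducible if every state can be reached from every state with positive probability; recurrent if, started from any state, it almost surely returns to that state; and positive recurrent if, started from any state, the expected time of its first return to that state is finite. For random walks $Y$ and $X$ on $\mathbb N^2$ write $Y\preceq X$ if, for every state $p$, $d_Y(p)\ge d_X(p)$, $\ell_Y(p)\ge \ell_X(p)$, $u_Y(p)\le u_X(p)$ and $r_Y(p)\le r_X(p)$. A random walk on $\mathbb N^2$ is weakly inward-homogeneous if its left, right and up probabilities are constants $\ell_x,r_x,u_x$ on $\{(i,0):i\ge1\}$, its down, up and right probabilities are constants $d_y,u_y,r_y$ on $\{(0,j):j\ge1\}$, its left, right, up and down probabilities are constants $\ell_q,r_q,u_q,d_q$ (all positive, so that the following ratios make sense)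 on $\{(i,j):i,j\ge1\}$, and $$\frac{\ell_x}{\ell_q},\frac{u_x}{u_q}\ \ge\ \frac{r_x}{r_q}\ \ge\ 1\qquad\text{and}\qquad \frac{d_y}{d_q},\frac{r_y}{r_q}\ \ge\ \frac{u_y}{u_q}\ \ge\ 1 .$$ (The probabilities at the origin are unrestricted.) Theorem. If an irreducible weakly inward-homogeneous random walk $X$ on $\mathbb N^2$ is recurrent (respectively, positive recurrent), then every irreducible random walk $Y$ on $\mathbb N^2$ such that $Y\preceq X$ is also recurrent (respectively, positive recurrent). -/

import Mathlib

open MeasureTheory ProbabilityTheory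
open scoped ENNReal

/-- A (not necessarily homogeneous) nearest-neighbour random walk on the quadrant `ℕ²`: at each
state, the probabilities of moving right, left, up and down. The moves that leave `ℕ²` are
forbidden. -/
structure QuadrantWalk where
  right : ℕ × ℕ → ℝ
  left : ℕ × ℕ → ℝ
  up : ℕ × ℕ → ℝ
  down : ℕ × ℕ → ℝ
  right_nonneg : ∀ p, 0 ≤ right p
  left_nonneg : ∀ p, 0 ≤ left p
  up_nonneg : ∀ p, 0 ≤ up p
  down_nonneg : ∀ p, 0 ≤ down p
  sum_eq_one : ∀ p, right p + left p + up p + down p = 1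
  left_boundary : ∀ j, left (0, j) = 0
  down_boundary : ∀ i, down (i, 0) = 0

namespace QuadrantWalk

/-- The one-step distribution from the state `p`. The truncated subtractions are harmless: where
they truncate, the corresponding probability is zero. -/
noncomputable def step (W : QuadrantWalk) (p : ℕ × ℕ) : Measure (ℕ × ℕ) :=
  ENNReal.ofReal (W.right p) • Measure.dirac (p.1 + 1, p.2)
    + ENNReal.ofReal (W.left p) • Measure.dirac (p.1 - 1, p.2)
    + ENNReal.ofReal (W.up p) • Measure.dirac (p.1, p.2 + 1)
    + ENNReal.ofReal (W.down p) • Measure.dirac (p.1, p.2 - 1)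

instance (W : QuadrantWalk) (p : ℕ × ℕ) : IsProbabilityMeasure (W.step p) where
  measure_univ := by
    have h := W.sum_eq_one p
    have h1 := W.right_nonneg p
    have h2 := W.left_nonneg p
    have h3 := W.up_nonneg p
    have h4 := W.down_nonneg p
    simp only [step, Measure.add_apply, Measure.smul_apply, measure_univ, smul_eq_mul, mul_one]
    rw [← ENNReal.ofReal_add h1 h2, ← ENNReal.ofReal_add (by positivity) h3,
      ← ENNReal.ofReal_add (by positivity) h4, h, ENNReal.ofReal_one]

/-- The transition kernel from the history up to time `n` to the state at time `n + 1`: it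
depends on the history only through the current state. -/
noncomputable def historyKernel (W : QuadrantWalk) (n : ℕ) :
    Kernel (∀ _ : Finset.Iic n, ℕ × ℕ) (ℕ × ℕ) where
  toFun h := W.step (h ⟨n, Finset.mem_Iic.2 le_rfl⟩)
  measurable' := (measurable_of_countable W.step).comp (measurable_pi_apply _)

instance (W : QuadrantWalk) (n : ℕ) : IsMarkovKernel (W.historyKernel n) where
  isProbabilityMeasure h :=
    inferInstanceAs (IsProbabilityMeasure (W.step (h ⟨n, Finset.mem_Iic.2 le_rfl⟩)))

/-- The law, on the space of trajectories, of the walk started at `x`. -/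
noncomputable def law (W : QuadrantWalk) (x : ℕ × ℕ) : Measure (ℕ → ℕ × ℕ) :=
  Kernel.traj (X := fun _ => ℕ × ℕ) W.historyKernel 0 (fun _ => x)

/-- Every state can be reached from every state through transitions of positive probability. -/
def Irreducible (W : QuadrantWalk) : Prop :=
  ∀ x y : ℕ × ℕ, Relation.ReflTransGen (fun a b => 0 < W.step a {b}) x y

/-- The first time `n ≥ 1` at which the trajectory `ω` is at `x` (`∞` if there is none). -/
noncomputable def returnTime (x : ℕ × ℕ) (ω : ℕ → ℕ × ℕ) : ℝ≥0∞ :=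
  ⨅ (n : ℕ) (_ : 1 ≤ n ∧ ω n = x), (n : ℝ≥0∞)

/-- From every state, the walk almost surely returns to that state. -/
def Recurrent (W : QuadrantWalk) : Prop :=
  ∀ x, ∀ᵐ ω ∂(W.law x), ∃ n, 1 ≤ n ∧ ω n = x

/-- From every state, the expected time of return to that state is finite. -/
def PositiveRecurrent (W : QuadrantWalk) : Prop :=
  ∀ x, ∫⁻ ω, returnTime x ω ∂(W.law x) < ∞

/-- `X ⪯ Y`: at each state, `X` goes down and left with at least the probabilities of `Y`, and up
and right with at most those of `Y`. -/
def Preceq (X Y : QuadrantWalk) : Prop :=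
  ∀ p, Y.down p ≤ X.down p ∧ Y.left p ≤ X.left p ∧ X.up p ≤ Y.up p ∧ X.right p ≤ Y.right p

/-- The transition probabilities are constant on the positive `x`-axis (`lx`, `rx`, `ux`), on the
positive `y`-axis (`dy`, `uy`, `ry`), and in the interior (`lq`, `rq`, `uq`, `dq`), and satisfy
`lx / lq, ux / uq ≥ rx / rq ≥ 1` and `dy / dq, ry / rq ≥ uy / uq ≥ 1`. As `a / 0 = 0`, these
inequalities force `lq`, `rq`, `uq` and `dq` to be nonzero, that is, all ratios make sense. -/
def WeaklyInwardHomogeneous (W : QuadrantWalk) : Prop :=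
  ∃ lx rx ux dy uy ry lq rq uq dq : ℝ,
    (∀ i, 1 ≤ i → W.left (i, 0) = lx ∧ W.right (i, 0) = rx ∧ W.up (i, 0) = ux) ∧
    (∀ j, 1 ≤ j → W.down (0, j) = dy ∧ W.up (0, j) = uy ∧ W.right (0, j) = ry) ∧
    (∀ i j, 1 ≤ i → 1 ≤ j → W.left (i, j) = lq ∧ W.right (i, j) = rq ∧
      W.up (i, j) = uq ∧ W.down (i, j) = dq) ∧
    rx / rq ≤ lx / lq ∧ rx / rq ≤ ux / uq ∧ 1 ≤ rx / rq ∧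
    uy / uq ≤ dy / dq ∧ uy / uq ≤ ry / rq ∧ 1 ≤ uy / uq

end QuadrantWalk

/-! A coordinatewise nondecreasing function has a smaller one-step mean under `Y` than under `X`
(`Preceq.mean_le`). So it suffices to find monotone Lyapunov functions for `X` off the origin; they
then serve `Y`. For recurrence these are the probabilities of reaching `{p | N ≤ p.1 + p.2}` before
`0`, which tend to `0` as `N` grows; for positive recurrence, a mean hitting time of `0`.

Their monotonicity is where inward-homogeneity enters. Slowing the walk on each axis by the ratio
`rx / rq`, resp. `uy / uq`, makes its outward rate along the axis equal to the interior one while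
its inward rate stays at least the interior one. With extra laziness `1/2`, the transition operator
preserves monotonicity away from the origin (`exists_slowedMean_mono`), and at the origin the
Lyapunov functions take their minimum. Slowing preserves harmonicity and changes hitting times by a
bounded factor only. Monotone iteration (`exists_coordMono_fixedPoint`) then produces the functions.
-/

open Filter Topology

/-! ### One-step means and avoidance probabilities -/

namespace QuadrantWalk

/-- The expectation of `f` after one step from `p`. -/
def mean (W : QuadrantWalk) (f : ℕ × ℕ → ℝ) (p : ℕ × ℕ) : ℝ :=
  W.right p * f (p.1 + 1, p.2) + W.left p * f (p.1 - 1, p.2)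
    + W.up p * f (p.1, p.2 + 1) + W.down p * f (p.1, p.2 - 1)

/-- The probability that the walk started at `p` avoids `x` at the times `1, …, n`. -/
def avoid (W : QuadrantWalk) (x : ℕ × ℕ) : ℕ → ℕ × ℕ → ℝ
  | 0, _ => 1
  | n + 1, p => W.mean (fun q => if q = x then 0 else W.avoid x n q) p

variable (W : QuadrantWalk)

lemma mean_mono {f g : ℕ × ℕ → ℝ} (h : ∀ p, f p ≤ g p) (p : ℕ × ℕ) : W.mean f p ≤ W.mean g p := by
  unfold mean
  have h1 := W.right_nonneg p
  have h2 := W.left_nonneg p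
  have h3 := W.up_nonneg p
  have h4 := W.down_nonneg p
  gcongr <;> apply h

lemma mean_const (c : ℝ) (p : ℕ × ℕ) : W.mean (fun _ => c) p = c := by
  unfold mean
  linear_combination c * W.sum_eq_one p

lemma mean_nonneg {f : ℕ × ℕ → ℝ} (h : ∀ p, 0 ≤ f p) (p : ℕ × ℕ) : 0 ≤ W.mean f p := by
  simpa only [mean_const] using W.mean_mono h p

lemma mean_add (f g : ℕ × ℕ → ℝ) (p : ℕ × ℕ) :
    W.mean (fun q => f q + g q) p = W.mean f p + W.mean g p := by
  unfold mean; ring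

lemma mean_sub (f g : ℕ × ℕ → ℝ) (p : ℕ × ℕ) :
    W.mean (fun q => f q - g q) p = W.mean f p - W.mean g p := by
  unfold mean; ring

lemma mean_const_mul (c : ℝ) (f : ℕ × ℕ → ℝ) (p : ℕ × ℕ) :
    W.mean (fun q => c * f q) p = c * W.mean f p := by
  unfold mean; ring

lemma tendsto_mean {f : ℕ → ℕ × ℕ → ℝ} {g : ℕ × ℕ → ℝ}
    (h : ∀ p, Tendsto (fun n => f n p) atTop (𝓝 (g p))) (p : ℕ × ℕ) :
    Tendsto (fun n => W.mean (f n) p) atTop (𝓝 (W.mean g p)) := by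
  unfold mean
  exact ((((h _).const_mul _).add ((h _).const_mul _)).add ((h _).const_mul _)).add
    ((h _).const_mul _)

lemma avoid_nonneg (x : ℕ × ℕ) (n : ℕ) (p : ℕ × ℕ) : 0 ≤ W.avoid x n p := by
  induction n generalizing p with
  | zero => exact zero_le_one
  | succ n ih =>
    refine W.mean_nonneg (fun q => ?_) p
    split_ifs
    exacts [le_rfl, ih q]

lemma avoid_succ_le (x : ℕ × ℕ) (n : ℕ) (p : ℕ × ℕ) : W.avoid x (n + 1) p ≤ W.avoid x n p := by
  induction n generalizing p with
  | zero =>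
    refine (W.mean_mono (g := fun _ => 1) (fun q => ?_) p).trans_eq (W.mean_const 1 p)
    split_ifs
    exacts [zero_le_one, le_rfl]
  | succ n ih =>
    refine W.mean_mono (fun q => ?_) p
    split_ifs
    exacts [le_rfl, ih q]

lemma avoid_antitone (x p : ℕ × ℕ) : Antitone (fun n => W.avoid x n p) :=
  antitone_nat_of_succ_le fun n => W.avoid_succ_le x n p

lemma avoid_le_one (x : ℕ × ℕ) (n : ℕ) (p : ℕ × ℕ) : W.avoid x n p ≤ 1 :=
  W.avoid_antitone x p (Nat.zero_le n)

/-! ### From the path measure to avoidance probabilities -/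

lemma lintegral_step {f : ℕ × ℕ → ℝ} (hf : ∀ p, 0 ≤ f p) (p : ℕ × ℕ) :
    ∫⁻ q, ENNReal.ofReal (f q) ∂W.step p = ENNReal.ofReal (W.mean f p) := by
  have h1 := W.right_nonneg p
  have h2 := W.left_nonneg p
  have h3 := W.up_nonneg p
  have h4 := W.down_nonneg p
  have k := hf
  simp only [step, lintegral_add_measure, lintegral_smul_measure, lintegral_dirac, smul_eq_mul]
  simp only [← ENNReal.ofReal_mul, h1, h2, h3, h4]
  rw [← ENNReal.ofReal_add, ← ENNReal.ofReal_add, ← ENNReal.ofReal_add, mean]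
  all_goals
    have := mul_nonneg h1 (k (p.1 + 1, p.2))
    have := mul_nonneg h2 (k (p.1 - 1, p.2))
    have := mul_nonneg h3 (k (p.1, p.2 + 1))
    have := mul_nonneg h4 (k (p.1, p.2 - 1))
    linarith

instance (x : ℕ × ℕ) : IsProbabilityMeasure (W.law x) := by
  unfold law; infer_instance

lemma lintegral_law_zero (x : ℕ × ℕ) (f : ℕ × ℕ → ℝ≥0∞) :
    ∫⁻ ω, f (ω 0) ∂W.law x = f x := by
  unfold law
  have hm : Measurable fun ω : ℕ → ℕ × ℕ => f (ω 0) :=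
    (measurable_of_countable f).comp (measurable_pi_apply 0)
  rw [Kernel.lintegral_traj (X := fun _ => ℕ × ℕ) _ hm]
  simp [Function.updateFinset]

/-- The Markov property at time `n`, for a functional `g` of the history. -/
lemma lintegral_law_succ (x : ℕ × ℕ) (n : ℕ) (g : (∀ _ : Finset.Iic n, ℕ × ℕ) → ℝ≥0∞)
    (f : ℕ × ℕ → ℝ≥0∞) :
    ∫⁻ ω, g (Preorder.frestrictLe n ω) * f (ω (n + 1)) ∂W.law x
      = ∫⁻ ω, g (Preorder.frestrictLe n ω) * ∫⁻ q, f q ∂W.step (ω n) ∂W.law x := by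
  have hg : Measurable g := measurable_of_countable g
  have hf : Measurable f := measurable_of_countable f
  have key := Kernel.partialTraj_compProd_eq_map_traj (X := fun _ => ℕ × ℕ)
    (κ := W.historyKernel) (Nat.zero_le n) (x₀ := fun _ => x)
  have hm : Measurable (fun z : (∀ _ : Finset.Iic n, ℕ × ℕ) × (ℕ × ℕ) => g z.1 * f z.2) := by
    fun_prop
  have h1 := congrArg (fun μ => ∫⁻ z, g z.1 * f z.2 ∂μ) key
  rw [lintegral_map hm (by fun_prop), Measure.lintegral_compProd hm,
    ← Kernel.traj_map_frestrictLe_apply,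
    lintegral_map (measurable_of_countable _) (by fun_prop)] at h1
  unfold law
  rw [← h1]
  refine lintegral_congr fun ω => ?_
  exact lintegral_const_mul (g (Preorder.frestrictLe n ω)) hf

/-- The trajectories that avoid `x` at the times `1, …, n`. -/
def avoidSet (x : ℕ × ℕ) (n : ℕ) : Set (ℕ → ℕ × ℕ) := {ω | ∀ j, 1 ≤ j → j ≤ n → ω j ≠ x}

lemma measurableSet_avoidSet (x : ℕ × ℕ) (n : ℕ) : MeasurableSet (avoidSet x n) := by
  have : avoidSet x n = ⋂ j, ⋂ (_ : 1 ≤ j), ⋂ (_ : j ≤ n), (fun ω => ω j) ⁻¹' {x}ᶜ := by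
    ext ω; simp [avoidSet]
  rw [this]
  exact .iInter fun j => .iInter fun _ => .iInter fun _ =>
    measurable_pi_apply j (MeasurableSet.of_discrete)

/-- Each induction step integrates out the last coordinate, turning one step of the path into one
step of the recursion for `avoid`; the free `k` makes this possible. -/
lemma lintegral_avoidSet (x p : ℕ × ℕ) (n k : ℕ) :
    ∫⁻ ω, (avoidSet x n).indicator 1 ω * ENNReal.ofReal (W.avoid x k (ω n)) ∂W.law p
      = ENNReal.ofReal (W.avoid x (n + k) p) := by
  classical
  induction n generalizing k with
  | zero =>
    have h : avoidSet x 0 = Set.univ := by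
      ext ω; simp only [avoidSet, Set.mem_ofPred_eq, Set.mem_univ, iff_true]; intro j; omega
    simp only [h, Set.indicator_univ, Pi.one_apply, one_mul, zero_add]
    exact W.lintegral_law_zero p fun q => ENNReal.ofReal (W.avoid x k q)
  | succ n ih =>
    obtain ⟨G, hG⟩ : ∃ G : (∀ _ : Finset.Iic n, ℕ × ℕ) → ℝ≥0∞, ∀ ω : ℕ → ℕ × ℕ,
        (avoidSet x n).indicator (1 : (ℕ → ℕ × ℕ) → ℝ≥0∞) ω = G (Preorder.frestrictLe n ω) := by
      refine ⟨fun h => if ∀ j : Finset.Iic n, 1 ≤ (j : ℕ) → h j ≠ x then 1 else 0, fun ω => ?_⟩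
      simp only [Set.indicator, avoidSet, Set.mem_ofPred_eq, Pi.one_apply, Subtype.forall,
        Finset.mem_Iic, Preorder.frestrictLe_apply]
      congr 1
      exact propext ⟨fun h j hj h1 => h j h1 hj, fun h j h1 hj => h j hj h1⟩
    have hs : ∀ ω : ℕ → ℕ × ℕ, (avoidSet x (n + 1)).indicator (1 : (ℕ → ℕ × ℕ) → ℝ≥0∞) ω
          * ENNReal.ofReal (W.avoid x k (ω (n + 1)))
        = (avoidSet x n).indicator 1 ω * ENNReal.ofReal
          ((fun q => if q = x then 0 else W.avoid x k q) (ω (n + 1))) := by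
      intro ω
      by_cases hx : ω (n + 1) = x
      · have : ω ∉ avoidSet x (n + 1) := fun h => h (n + 1) (by omega) le_rfl hx
        simp [this, hx]
      · have : ω ∈ avoidSet x (n + 1) ↔ ω ∈ avoidSet x n := by
          constructor
          · exact fun h j h1 h2 => h j h1 (by omega)
          · intro h j h1 h2
            rcases Nat.lt_or_ge n j with h3 | h3
            · obtain rfl : j = n + 1 := by omega
              exact hx
            · exact h j h1 h3
        simp [Set.indicator, this, hx]
    rw [lintegral_congr hs]
    simp_rw [hG]
    rw [W.lintegral_law_succ p n G fun q => ENNReal.ofReal (if q = x then 0 else W.avoid x k q)]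
    simp_rw [← hG]
    rw [show n + 1 + k = n + (k + 1) by omega, ← ih (k + 1)]
    refine lintegral_congr fun ω => ?_
    rw [W.lintegral_step]
    · rfl
    · intro q
      split_ifs
      exacts [le_rfl, W.avoid_nonneg x k q]

lemma law_avoidSet (x p : ℕ × ℕ) (n : ℕ) :
    W.law p (avoidSet x n) = ENNReal.ofReal (W.avoid x n p) := by
  have h := W.lintegral_avoidSet x p n 0
  simp only [avoid, ENNReal.ofReal_one, mul_one, add_zero] at h
  rw [← h, lintegral_indicator_one (measurableSet_avoidSet x n)]

lemma recurrent_iff :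
    W.Recurrent ↔ ∀ x, Tendsto (fun n => W.avoid x n x) atTop (𝓝 0) := by
  refine forall_congr' fun x => ?_
  have hanti : Antitone (avoidSet x) := fun m n h ω hω j h1 h2 => hω j h1 (h2.trans h)
  have hlim := tendsto_measure_iInter_atTop (μ := W.law x)
    (fun n => (measurableSet_avoidSet x n).nullMeasurableSet) hanti ⟨0, measure_ne_top _ _⟩
  have hset : {ω : ℕ → ℕ × ℕ | ¬ ∃ n, 1 ≤ n ∧ ω n = x} = ⋂ n, avoidSet x n := by
    ext ω
    simp only [Set.mem_ofPred_eq, avoidSet, Set.mem_iInter]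
    push Not
    exact ⟨fun h _ j h1 _ => h j h1, fun h j h1 => h j j h1 le_rfl⟩
  rw [ae_iff, hset]
  have hfun : (W.law x ∘ fun n => avoidSet x n) = fun n => ENNReal.ofReal (W.avoid x n x) :=
    funext fun n => W.law_avoidSet x x n
  rw [show (⇑(W.law x) ∘ avoidSet x) = fun n => ENNReal.ofReal (W.avoid x n x) from hfun] at hlim
  constructor
  · intro h
    rw [h] at hlim
    have := (ENNReal.tendsto_toReal ENNReal.zero_ne_top).comp hlim
    simpa [Function.comp_def, ENNReal.toReal_ofReal (W.avoid_nonneg x _ x)] using this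
  · intro h
    have := ENNReal.tendsto_ofReal h
    rw [ENNReal.ofReal_zero] at this
    exact tendsto_nhds_unique hlim this

/-- Tail-sum formula: `ω` lies in `avoidSet x n` exactly when its first return comes after time `n`.
-/
lemma returnTime_eq_tsum (x : ℕ × ℕ) (ω : ℕ → ℕ × ℕ) :
    returnTime x ω = ∑' n, (avoidSet x n).indicator 1 ω := by
  classical
  by_cases h : ∃ n, 1 ≤ n ∧ ω n = x
  · have hmem : ∀ n, ω ∈ avoidSet x n ↔ n < Nat.find h := by
      intro n
      constructor
      · intro hn
        by_contra! hle
        exact hn _ (Nat.find_spec h).1 hle (Nat.find_spec h).2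
      · intro hn j h1 h2 hx
        exact Nat.find_min h (h2.trans_lt hn) ⟨h1, hx⟩
    have hsum : ∑' n, (avoidSet x n).indicator (1 : (ℕ → ℕ × ℕ) → ℝ≥0∞) ω = Nat.find h := by
      rw [tsum_eq_sum (s := Finset.range (Nat.find h))]
      · rw [Finset.sum_congr rfl (g := fun _ => (1 : ℝ≥0∞))]
        · simp
        · intro n hn
          simp [(hmem n).2 (Finset.mem_range.1 hn)]
      · intro n hn
        simp [mt (hmem n).1 (by simpa using hn)]
    rw [hsum]
    refine le_antisymm (iInf₂_le (Nat.find h) (Nat.find_spec h)) (le_iInf₂ fun n hn => ?_)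
    exact_mod_cast Nat.find_min' h hn
  · have hmem : ∀ n, ω ∈ avoidSet x n := fun n j h1 _ hx => h ⟨j, h1, hx⟩
    have : returnTime x ω = ∞ := by
      refine iInf₂_eq_top.2 fun n hn => absurd ⟨n, hn⟩ h
    simp [this, hmem]

/-- The expectation of the minimum of `n` and the first time `≥ 1` at which the walk is at `x`. -/
def truncTime (x : ℕ × ℕ) (n : ℕ) (p : ℕ × ℕ) : ℝ := ∑ k ∈ Finset.range n, W.avoid x k p

lemma positiveRecurrent_iff :
    W.PositiveRecurrent ↔ ∀ x, BddAbove (Set.range fun n => W.truncTime x n x) := by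
  refine forall_congr' fun x => ?_
  have hint : ∫⁻ ω, returnTime x ω ∂W.law x = ∑' n, ENNReal.ofReal (W.avoid x n x) := by
    simp_rw [returnTime_eq_tsum]
    rw [lintegral_tsum fun n =>
      (measurable_one.indicator (measurableSet_avoidSet x n)).aemeasurable]
    refine tsum_congr fun n => ?_
    rw [lintegral_indicator_one (measurableSet_avoidSet x n), law_avoidSet]
  rw [hint]
  constructor
  · intro h
    refine ⟨(∑' n, ENNReal.ofReal (W.avoid x n x)).toReal, ?_⟩
    rintro _ ⟨n, rfl⟩
    unfold truncTime
    rw [← ENNReal.ofReal_le_iff_le_toReal h.ne, ENNReal.ofReal_sum_of_nonneg fun k _ => W.avoid_nonneg x k x]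
    exact ENNReal.sum_le_tsum _
  · rintro ⟨C, hC⟩
    have hs : Summable fun n => W.avoid x n x :=
      summable_of_sum_range_le (c := C) (fun n => W.avoid_nonneg x n x) fun n => hC ⟨n, rfl⟩
    rw [← ENNReal.ofReal_tsum_of_nonneg (fun n => W.avoid_nonneg x n x) hs]
    exact ENNReal.ofReal_lt_top

end QuadrantWalk

/-! ### Lyapunov criteria for irreducible walks -/

namespace QuadrantWalk

variable {W : QuadrantWalk}

/-- The constant is the probability of one of the moves from `a` to `b`. Irreducibility is exploited
through this bound, edge by edge. -/
lemma exists_mul_le_mean {a b : ℕ × ℕ} (h : 0 < W.step a {b}) :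
    ∃ c, 0 < c ∧ ∀ f : ℕ × ℕ → ℝ, (∀ p, 0 ≤ f p) → c * f b ≤ W.mean f a := by
  have h1 := W.right_nonneg a
  have h2 := W.left_nonneg a
  have h3 := W.up_nonneg a
  have h4 := W.down_nonneg a
  have key : (0 < W.right a ∧ (a.1 + 1, a.2) = b) ∨ (0 < W.left a ∧ (a.1 - 1, a.2) = b)
      ∨ (0 < W.up a ∧ (a.1, a.2 + 1) = b) ∨ (0 < W.down a ∧ (a.1, a.2 - 1) = b) := by
    by_contra! hc
    obtain ⟨k1, k2, k3, k4⟩ := hc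
    have aux : ∀ (r : ℝ) (q : ℕ × ℕ), (0 < r → q ≠ b) →
        ENNReal.ofReal r * Measure.dirac q {b} = 0 := by
      intro r q hq
      rcases le_or_gt r 0 with hr | hr
      · simp [ENNReal.ofReal_of_nonpos hr]
      · simp [hq hr]
    simp only [step, Measure.add_apply, Measure.smul_apply, smul_eq_mul] at h
    rw [aux _ _ k1, aux _ _ k2, aux _ _ k3, aux _ _ k4] at h
    simp at h
  unfold mean
  rcases key with ⟨hc, rfl⟩ | ⟨hc, rfl⟩ | ⟨hc, rfl⟩ | ⟨hc, rfl⟩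
  all_goals
    refine ⟨_, hc, fun f hf => ?_⟩
    have := mul_nonneg h1 (hf (a.1 + 1, a.2))
    have := mul_nonneg h2 (hf (a.1 - 1, a.2))
    have := mul_nonneg h3 (hf (a.1, a.2 + 1))
    have := mul_nonneg h4 (hf (a.1, a.2 - 1))
    linarith

lemma eq_max_of_step {f : ℕ × ℕ → ℝ} {M : ℝ} (hf : ∀ p, f p ≤ M) {a b : ℕ × ℕ} (ha : f a = M)
    (hsub : f a ≤ W.mean f a) (h : 0 < W.step a {b}) : f b = M := by
  obtain ⟨c, hc, hle⟩ := exists_mul_le_mean h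
  have h1 := hle (fun q => M - f q) fun p => sub_nonneg.2 (hf p)
  rw [mean_sub, mean_const] at h1
  have : M - f b ≤ 0 := by
    by_contra! hpos
    have := mul_pos hc hpos
    linarith
  linarith [hf b]

lemma eq_max_of_path {f : ℕ × ℕ → ℝ} {M : ℝ} (hf : ∀ p, f p ≤ M)
    (hsub : ∀ p, f p = M → f p ≤ W.mean f p) {a b : ℕ × ℕ}
    (h : Relation.ReflTransGen (fun a b => 0 < W.step a {b}) a b) (ha : f a = M) : f b = M := by
  induction h with
  | refl => exact ha
  | tail _ hbc ih => exact eq_max_of_step hf ih (hsub _ ih) hbc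

lemma Irreducible.exists_avoid_lt_one (hW : W.Irreducible) {x p : ℕ × ℕ} (hp : p ≠ x) :
    ∃ n, W.avoid x n p < 1 := by
  suffices ∀ p, ∃ n, (if p = x then 0 else W.avoid x n p) < 1 by simpa [hp] using this p
  intro p
  induction hW p x using Relation.ReflTransGen.head_induction_on with
  | refl => exact ⟨0, by simp⟩
  | @head a b hab _ ih =>
    obtain ⟨n, hn⟩ := ih
    obtain ⟨c, hc, hle⟩ := exists_mul_le_mean hab
    refine ⟨n + 1, ?_⟩
    split_ifs
    · exact zero_lt_one
    have h1 := hle (fun q => 1 - if q = x then 0 else W.avoid x n q) (fun q => by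
      split_ifs
      · norm_num
      · linarith [W.avoid_le_one x n q])
    rw [mean_sub, mean_const] at h1
    have := mul_pos hc (sub_pos.2 hn)
    change W.mean _ a < 1
    linarith

-- The limit is the probability of never visiting `x` at a positive time; the equation is the
-- first-step decomposition.
variable (W) in
lemma exists_tendsto_avoid (x : ℕ × ℕ) :
    ∃ a : ℕ × ℕ → ℝ, (∀ p, Tendsto (fun n => W.avoid x n p) atTop (𝓝 (a p))) ∧
      (∀ p, 0 ≤ a p) ∧ (∀ p, a p ≤ 1) ∧
      ∀ p, a p = W.mean (fun q => if q = x then 0 else a q) p := by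
  have hlim : ∀ p, Tendsto (fun n => W.avoid x n p) atTop (𝓝 (⨅ n, W.avoid x n p)) := fun p =>
    tendsto_atTop_ciInf (W.avoid_antitone x p) ⟨0, by
      rintro _ ⟨n, rfl⟩
      exact W.avoid_nonneg x n p⟩
  refine ⟨fun p => ⨅ n, W.avoid x n p, hlim,
    fun p => ge_of_tendsto' (hlim p) fun n => W.avoid_nonneg x n p,
    fun p => le_of_tendsto' (hlim p) fun n => W.avoid_le_one x n p, fun p => ?_⟩
  have h2 := W.tendsto_mean (f := fun n q => if q = x then 0 else W.avoid x n q)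
    (g := fun q => if q = x then 0 else ⨅ n, W.avoid x n q) (fun q => by
      split_ifs
      exacts [tendsto_const_nhds, hlim q]) p
  exact tendsto_nhds_unique ((hlim p).comp (tendsto_add_atTop_nat 1)) h2

/-- If the escape probability vanishes at `b`, so does the mean of a nonnegative function there,
hence its value at each successor. Zeros thus spread from `x` along paths. -/
lemma Recurrent.tendsto_avoid (hW : W.Irreducible) (h : W.Recurrent) (x p : ℕ × ℕ) :
    Tendsto (fun n => W.avoid x n p) atTop (𝓝 0) := by
  obtain ⟨a, hlim, ha0, -, heq⟩ := W.exists_tendsto_avoid x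
  have hx : a x = 0 := tendsto_nhds_unique (hlim x) (W.recurrent_iff.1 h x)
  suffices a p = 0 by simpa [this] using hlim p
  induction hW x p with
  | refl => exact hx
  | @tail b c _ hbc ih =>
    by_cases hcx : c = x
    · rw [hcx, hx]
    obtain ⟨d, hd, hle⟩ := exists_mul_le_mean hbc
    have h1 := hle (fun q => if q = x then 0 else a q) fun q => by
      split_ifs
      exacts [le_rfl, ha0 q]
    rw [← heq, ih] at h1
    simp only [hcx, if_false] at h1
    refine le_antisymm ?_ (ha0 c)
    by_contra! hpos
    exact absurd h1 (mul_pos hd hpos).not_ge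

/-- The maximum principle on `{p ≠ 0 | p.1 + p.2 < N}`. -/
lemma Irreducible.le_of_subharmonic (hW : W.Irreducible) {f : ℕ × ℕ → ℝ} {c : ℝ} {N : ℕ}
    (h0 : f 0 ≤ c) (hN : ∀ p : ℕ × ℕ, N ≤ p.1 + p.2 → f p ≤ c)
    (hsub : ∀ p : ℕ × ℕ, p ≠ 0 → p.1 + p.2 < N → f p ≤ W.mean f p) (p : ℕ × ℕ) : f p ≤ c := by
  by_contra! hp
  have hint : ∀ q : ℕ × ℕ, c < f q → q ≠ 0 ∧ q.1 + q.2 < N := by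
    refine fun q hq => ⟨?_, ?_⟩
    · rintro rfl
      exact absurd h0 hq.not_ge
    · by_contra! hle
      exact absurd (hN q hle) hq.not_ge
  have hmem : ∀ q : ℕ × ℕ, c < f q → q ∈ Finset.range N ×ˢ Finset.range N := by
    intro q hq
    have := (hint q hq).2
    simp only [Finset.mem_product, Finset.mem_range]
    omega
  obtain ⟨m, -, hm⟩ := Finset.exists_max_image _ f ⟨p, hmem p hp⟩
  have hcm : c < f m := hp.trans_le (hm p (hmem p hp))
  have hmax : ∀ q, f q ≤ f m := by
    intro q
    rcases le_or_gt (f q) c with hq | hq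
    · exact hq.trans hcm.le
    · exact hm q (hmem q hq)
  have hpath : f 0 = f m := eq_max_of_path hmax (fun a ha => by
    have := hint a (ha ▸ hcm)
    exact hsub a this.1 this.2) (hW m 0) rfl
  linarith

/-- The escape probability from `x`, reset to `0` at `x`, is a bounded subharmonic `h`. Comparison
with `h 0 + V N` and `N → ∞` show that `h` is maximal at `0`; the maximum spreads to `x`, where `h`
vanishes, so `h = 0`. -/
theorem Irreducible.recurrent_of_superharmonic (hW : W.Irreducible) (V : ℕ → ℕ × ℕ → ℝ)
    (hV0 : ∀ N p, 0 ≤ V N p) (hV1 : ∀ (N : ℕ) (p : ℕ × ℕ), N ≤ p.1 + p.2 → 1 ≤ V N p)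
    (hsup : ∀ (N : ℕ) (p : ℕ × ℕ), p ≠ 0 → p.1 + p.2 < N → W.mean (V N) p ≤ V N p)
    (hlim : ∀ p, Tendsto (fun N => V N p) atTop (𝓝 0)) : W.Recurrent := by
  refine W.recurrent_iff.2 fun x => ?_
  obtain ⟨a, ha, ha0, ha1, heq⟩ := W.exists_tendsto_avoid x
  obtain ⟨h, hh⟩ : ∃ h : ℕ × ℕ → ℝ, h = fun q => if q = x then 0 else a q := ⟨_, rfl⟩
  rw [← hh] at heq
  have hx : h x = 0 := by simp [hh]
  have h0 : ∀ p, 0 ≤ h p := fun p => by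
    rw [hh]; dsimp only
    split_ifs
    exacts [le_rfl, ha0 p]
  have h1 : ∀ p, h p ≤ 1 := fun p => by
    rw [hh]; dsimp only
    split_ifs
    exacts [zero_le_one, ha1 p]
  have hsub : ∀ p, h p ≤ W.mean h p := fun p => by
    by_cases hp : p = x
    · rw [hp, hx]
      exact W.mean_nonneg h0 x
    · rw [← heq, hh]
      simp [hp]
  have hle : ∀ p, h p ≤ h 0 := by
    intro p
    have hN : ∀ N, h p ≤ h 0 + V N p := by
      intro N
      have := hW.le_of_subharmonic (f := fun q => h q - V N q) (c := h 0) (N := N)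
        (by linarith [hV0 N 0]) (fun q hq => by linarith [hV1 N q hq, h1 q, h0 0])
        (fun q hq hqN => by
          rw [mean_sub]
          linarith [hsub q, hsup N q hq hqN]) p
      linarith
    have := (hlim p).const_add (h 0)
    rw [add_zero] at this
    exact ge_of_tendsto' this hN
  have h00 : h x = h 0 := eq_max_of_path hle (fun b _ => hsub b) (hW 0 x) rfl
  have hzero : h = fun _ => 0 := funext fun p => le_antisymm (by linarith [hle p]) (h0 p)
  have hax : a x = 0 := by rw [heq, hzero, mean_const]
  simpa [hax] using ha x

variable (W) in
lemma truncTime_succ (x : ℕ × ℕ) (n : ℕ) (p : ℕ × ℕ) :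
    W.truncTime x (n + 1) p
      = 1 + W.mean (fun q => if q = x then 0 else W.truncTime x n q) p := by
  induction n with
  | zero => simp [truncTime, avoid, mean]
  | succ n ih =>
    have h1 : W.truncTime x (n + 2) p = W.truncTime x (n + 1) p + W.avoid x (n + 1) p :=
      Finset.sum_range_succ _ _
    have h2 : (fun q => if q = x then 0 else W.truncTime x (n + 1) q) = fun q =>
        (if q = x then 0 else W.truncTime x n q) + if q = x then 0 else W.avoid x n q := by
      funext q
      split_ifs
      · simp
      · exact Finset.sum_range_succ _ _
    rw [h1, ih, h2, mean_add, add_assoc]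
    rfl

variable (W) in
lemma truncTime_nonneg (x : ℕ × ℕ) (n : ℕ) (p : ℕ × ℕ) : 0 ≤ W.truncTime x n p :=
  Finset.sum_nonneg fun k _ => W.avoid_nonneg x k p

variable (W) in
lemma truncTime_monotone (x p : ℕ × ℕ) : Monotone fun n => W.truncTime x n p :=
  monotone_nat_of_le_succ fun n => by
    simp only [truncTime, Finset.sum_range_succ]
    linarith [W.avoid_nonneg x n p]

lemma bddAbove_truncTime_of_foster {x : ℕ × ℕ} {V : ℕ × ℕ → ℝ} (hV0 : ∀ p, 0 ≤ V p)
    (hV : ∀ p, p ≠ x → W.mean V p ≤ V p - 1) :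
    BddAbove (Set.range fun n => W.truncTime x n x) := by
  have hstep : ∀ n, (∀ q, q ≠ x → W.truncTime x n q ≤ V q) →
      ∀ p, W.truncTime x (n + 1) p ≤ 1 + W.mean V p := by
    intro n hn p
    rw [truncTime_succ]
    gcongr
    refine W.mean_mono (fun q => ?_) p
    split_ifs with hq
    exacts [hV0 q, hn q hq]
  have hle : ∀ n p, p ≠ x → W.truncTime x n p ≤ V p := by
    intro n
    induction n with
    | zero => exact fun p _ => by simpa [truncTime] using hV0 p
    | succ n ih => exact fun p hp => by linarith [hstep n ih p, hV p hp]
  refine ⟨1 + W.mean V x, ?_⟩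
  rintro _ ⟨n, rfl⟩
  exact (W.truncTime_monotone x x n.le_succ).trans (hstep n (hle n) x)

/-- To move the target from `0` to `x`, add `K * g` with `g` the probability of avoiding `x` for `n`
steps, reset to `0` at `x`. It is superharmonic off `x` and, for suitable `n`, strictly so at `0`,
where a large `K` restores the drift. -/
theorem Irreducible.positiveRecurrent_of_foster (hW : W.Irreducible) {V : ℕ × ℕ → ℝ}
    (hV0 : ∀ p, 0 ≤ V p) (hV : ∀ p, p ≠ 0 → W.mean V p ≤ V p - 1) : W.PositiveRecurrent := by
  refine W.positiveRecurrent_iff.2 fun x => ?_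
  by_cases hx : 0 = x
  · subst hx
    exact bddAbove_truncTime_of_foster hV0 hV
  -- Otherwise the avoidance probability from `0` would never drop below its initial value `1`.
  obtain ⟨n, hn⟩ : ∃ n, W.avoid x (n + 1) 0 < W.avoid x n 0 := by
    by_contra! hc
    obtain ⟨m, hm⟩ := hW.exists_avoid_lt_one hx
    exact absurd (monotone_nat_of_le_succ hc (Nat.zero_le m)) hm.not_ge
  obtain ⟨g, hg⟩ : ∃ g : ℕ × ℕ → ℝ, g = fun q => if q = x then 0 else W.avoid x n q := ⟨_, rfl⟩
  have hg0 : ∀ p, 0 ≤ g p := fun p => by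
    rw [hg]; dsimp only
    split_ifs
    exacts [le_rfl, W.avoid_nonneg x n p]
  have hgm : ∀ p, W.mean g p = W.avoid x (n + 1) p := fun p => by rw [hg]; rfl
  have hgx : ∀ p, p ≠ x → g p = W.avoid x n p := fun p hp => by simp [hg, hp]
  have hδ : 0 < W.avoid x n 0 - W.avoid x (n + 1) 0 := sub_pos.2 hn
  obtain ⟨K, hK0, hK⟩ : ∃ K, 0 ≤ K ∧
      1 + W.mean V 0 - V 0 ≤ K * (W.avoid x n 0 - W.avoid x (n + 1) 0) := by
    refine ⟨|1 + W.mean V 0 - V 0| / (W.avoid x n 0 - W.avoid x (n + 1) 0), by positivity, ?_⟩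
    rw [div_mul_cancel₀ _ hδ.ne']
    exact le_abs_self _
  refine bddAbove_truncTime_of_foster (V := fun p => V p + K * g p)
    (fun p => add_nonneg (hV0 p) (mul_nonneg hK0 (hg0 p))) fun p hp => ?_
  rw [mean_add, mean_const_mul, hgm, hgx p hp]
  by_cases hp0 : p = 0
  · subst hp0
    linarith
  · have := mul_le_mul_of_nonneg_left (W.avoid_succ_le x n p) hK0
    linarith [hV p hp0]

/-- `S` is the mean hitting time of `0`. Its finiteness spreads from `0` along paths by the
first-step equation. -/
lemma PositiveRecurrent.exists_foster (hW : W.Irreducible) (h : W.PositiveRecurrent) :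
    ∃ S : ℕ × ℕ → ℝ, (∀ p, 0 ≤ S p) ∧ ∀ p, p ≠ 0 → W.mean S p = S p - 1 := by
  have hbdd : ∀ p, BddAbove (Set.range fun n => W.truncTime 0 n p) := by
    intro p
    induction hW 0 p with
    | refl => exact W.positiveRecurrent_iff.1 h 0
    | @tail b c _ hbc ih =>
      by_cases hc : c = 0
      · rw [hc]
        exact W.positiveRecurrent_iff.1 h 0
      obtain ⟨C, hC⟩ := ih
      obtain ⟨d, hd, hle⟩ := exists_mul_le_mean hbc
      refine ⟨C / d, ?_⟩
      rintro _ ⟨n, rfl⟩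
      have h1 := hle (fun q => if q = 0 then 0 else W.truncTime 0 n q) fun q => by
        split_ifs
        exacts [le_rfl, W.truncTime_nonneg 0 n q]
      simp only [hc, if_false] at h1
      have h2 : W.truncTime 0 (n + 1) b ≤ C := hC ⟨n + 1, rfl⟩
      rw [truncTime_succ] at h2
      rw [le_div_iff₀ hd]
      linarith
  have hlim := fun p => tendsto_atTop_ciSup (W.truncTime_monotone 0 p) (hbdd p)
  refine ⟨fun p => if p = 0 then 0 else ⨆ n, W.truncTime 0 n p, fun p => ?_, fun p hp => ?_⟩
  · dsimp only
    split_ifs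
    · exact le_rfl
    · exact ge_of_tendsto' (hlim p) fun n => W.truncTime_nonneg 0 n p
  · have h1 := (hlim p).comp (tendsto_add_atTop_nat 1)
    have h2 := (W.tendsto_mean (f := fun n q => if q = 0 then 0 else W.truncTime 0 n q)
      (g := fun q => if q = 0 then 0 else ⨆ n, W.truncTime 0 n q) (fun q => by
        split_ifs
        exacts [tendsto_const_nhds, hlim q]) p).const_add 1
    have h3 := tendsto_nhds_unique h1 (h2.congr fun n => (W.truncTime_succ 0 n p).symm)
    simp only [hp, if_false]
    linarith

end QuadrantWalk

/-! ### Monotone functions and the slowed walk -/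

namespace QuadrantWalk

/-- Monotonicity in each of the two coordinates. -/
def CoordMono (f : ℕ × ℕ → ℝ) : Prop :=
  (∀ i j, f (i, j) ≤ f (i + 1, j)) ∧ ∀ i j, f (i, j) ≤ f (i, j + 1)

lemma Preceq.mean_le {X Y : QuadrantWalk} (h : Y.Preceq X) {f : ℕ × ℕ → ℝ} (hf : CoordMono f)
    (p : ℕ × ℕ) : Y.mean f p ≤ X.mean f p := by
  obtain ⟨i, j⟩ := p
  obtain ⟨hd, hl, hu, hr⟩ := h (i, j)
  have hleft : f (i - 1, j) ≤ f (i, j) := by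
    cases i with
    | zero => exact le_rfl
    | succ i => exact hf.1 i j
  have hdown : f (i, j - 1) ≤ f (i, j) := by
    cases j with
    | zero => exact le_rfl
    | succ j => exact hf.2 i j
  have h1 := mul_nonneg (sub_nonneg.2 hd) (sub_nonneg.2 hdown)
  have h2 := mul_nonneg (sub_nonneg.2 hl) (sub_nonneg.2 hleft)
  have h3 := mul_nonneg (sub_nonneg.2 hu) (sub_nonneg.2 (hf.2 i j))
  have h4 := mul_nonneg (sub_nonneg.2 hr) (sub_nonneg.2 (hf.1 i j))
  have hX := X.sum_eq_one (i, j)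
  have hY := Y.sum_eq_one (i, j)
  simp only [mean]
  linear_combination h1 + h2 + h3 + h4 + f (i, j) * (hY - hX)

/-- The one-step expectation for the walk `W` slowed down so that it moves from `p` with
probability `1 / (2 * κ p)`. -/
noncomputable def slowedMean (W : QuadrantWalk) (κ f : ℕ × ℕ → ℝ) (p : ℕ × ℕ) : ℝ :=
  f p + (W.mean f p - f p) / (2 * κ p)

lemma slowedMean_mono (W : QuadrantWalk) {κ : ℕ × ℕ → ℝ} (hκ : ∀ p, 1 ≤ κ p) {f g : ℕ × ℕ → ℝ}
    (h : ∀ p, f p ≤ g p) (p : ℕ × ℕ) : W.slowedMean κ f p ≤ W.slowedMean κ g p := by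
  have h0 : 0 < 2 * κ p := by linarith [hκ p]
  have h1 : 1 / (2 * κ p) ≤ 1 := by
    rw [div_le_one h0]; linarith [hκ p]
  have h2 : 0 < 1 / (2 * κ p) := by positivity
  have h3 := mul_le_mul_of_nonneg_left (h p) (sub_nonneg.2 h1)
  have h4 := mul_le_mul_of_nonneg_left (W.mean_mono h p) h2.le
  have e : ∀ h, W.slowedMean κ h p = (1 - 1 / (2 * κ p)) * h p + 1 / (2 * κ p) * W.mean h p := by
    intro h; unfold slowedMean; ring
  rw [e, e]
  exact add_le_add h3 h4

lemma slowedMean_const (W : QuadrantWalk) (κ : ℕ × ℕ → ℝ) (c : ℝ) (p : ℕ × ℕ) :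
    W.slowedMean κ (fun _ => c) p = c := by
  simp [slowedMean, mean_const]

lemma tendsto_slowedMean (W : QuadrantWalk) (κ : ℕ × ℕ → ℝ) {f : ℕ → ℕ × ℕ → ℝ} {g : ℕ × ℕ → ℝ}
    (h : ∀ p, Tendsto (fun n => f n p) atTop (𝓝 (g p))) (p : ℕ × ℕ) :
    Tendsto (fun n => W.slowedMean κ (f n) p) atTop (𝓝 (W.slowedMean κ g p)) :=
  (h p).add (((W.tendsto_mean h p).sub (h p)).div_const _)

/-- If the walk is slowed down on each axis so that its probability of moving outwards along the
axis becomes the one in the interior, then its transition operator preserves monotonicity. -/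
theorem WeaklyInwardHomogeneous.exists_slowedMean_mono {W : QuadrantWalk}
    (hW : W.WeaklyInwardHomogeneous) :
    ∃ (κ : ℕ × ℕ → ℝ) (K : ℝ), (∀ p, 1 ≤ κ p) ∧ (∀ p, κ p ≤ K) ∧ ∀ f, CoordMono f →
      (∀ i j, (i, j) ≠ (0, 0) → W.slowedMean κ f (i, j) ≤ W.slowedMean κ f (i + 1, j)) ∧
      ∀ i j, (i, j) ≠ (0, 0) → W.slowedMean κ f (i, j) ≤ W.slowedMean κ f (i, j + 1) := by
  obtain ⟨lx, rx, ux, dy, uy, ry, lq, rq, uq, dq, hx, hy, hq, h1, h2, h3, h4, h5, h6⟩ := hW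
  obtain ⟨hl, hr, hu, hd⟩ := hq 1 1 le_rfl le_rfl
  have hsum : rq + lq + uq + dq = 1 := by
    rw [← hl, ← hr, ← hu, ← hd]; exact W.sum_eq_one (1, 1)
  have pos : ∀ a b : ℝ, 0 ≤ b → 1 ≤ a / b → 0 < b := by
    intro a b hb hab
    refine hb.lt_of_ne ?_
    rintro rfl
    norm_num at hab
  have hl0 : 0 < lq := pos lx lq (hl ▸ W.left_nonneg (1, 1)) (h3.trans h1)
  have hr0 : 0 < rq := pos rx rq (hr ▸ W.right_nonneg (1, 1)) h3
  have hu0 : 0 < uq := pos uy uq (hu ▸ W.up_nonneg (1, 1)) h6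
  have hd0 : 0 < dq := pos dy dq (hd ▸ W.down_nonneg (1, 1)) (h6.trans h4)
  obtain ⟨a, ha⟩ : ∃ a, a = rx / rq := ⟨_, rfl⟩
  obtain ⟨b, hb⟩ : ∃ b, b = uy / uq := ⟨_, rfl⟩
  rw [← ha] at h1 h2 h3
  rw [← hb] at h4 h5 h6
  have ha0 : 0 < a := by linarith
  have hb0 : 0 < b := by linarith
  have hrx : rx = a * rq := by rw [ha]; field_simp
  have huy : uy = b * uq := by rw [hb]; field_simp
  -- `L`, `U`, `D`, `R` are the axis rates after division by `a` or `b`; the outward rates along the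
  -- axes become `rq` and `uq`.
  obtain ⟨L, hL⟩ : ∃ L, lx = a * L := ⟨lx / a, by field_simp⟩
  obtain ⟨U, hU⟩ : ∃ U, ux = a * U := ⟨ux / a, by field_simp⟩
  obtain ⟨D, hD⟩ : ∃ D, dy = b * D := ⟨dy / b, by field_simp⟩
  obtain ⟨R, hR⟩ : ∃ R, ry = b * R := ⟨ry / b, by field_simp⟩
  have hLl : lq ≤ L := by
    rw [le_div_iff₀ hl0, hL] at h1; exact le_of_mul_le_mul_left h1 ha0
  have hUu : uq ≤ U := by
    rw [le_div_iff₀ hu0, hU] at h2; exact le_of_mul_le_mul_left h2 ha0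
  have hDd : dq ≤ D := by
    rw [le_div_iff₀ hd0, hD] at h4; exact le_of_mul_le_mul_left h4 hb0
  have hRr : rq ≤ R := by
    rw [le_div_iff₀ hr0, hR] at h5; exact le_of_mul_le_mul_left h5 hb0
  have hsx : a * (rq + L + U) = 1 := by
    have := W.sum_eq_one (1, 0)
    rw [(hx 1 le_rfl).1, (hx 1 le_rfl).2.1, (hx 1 le_rfl).2.2, W.down_boundary, hrx, hL, hU] at this
    linarith
  have hsy : b * (R + uq + D) = 1 := by
    have := W.sum_eq_one (0, 1)
    rw [(hy 1 le_rfl).1, (hy 1 le_rfl).2.1, (hy 1 le_rfl).2.2, W.left_boundary, huy, hD, hR] at this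
    linarith
  have hsx1 : rq + L + U ≤ 1 := by nlinarith
  have hsy1 : R + uq + D ≤ 1 := by nlinarith
  obtain ⟨κ, hκ⟩ : ∃ κ : ℕ × ℕ → ℝ, κ = fun p =>
    if p.1 = 0 then if p.2 = 0 then 1 else b else if p.2 = 0 then a else 1 := ⟨_, rfl⟩
  have hκx : ∀ i, κ (i + 1, 0) = a := fun i => by simp [hκ]
  have hκy : ∀ j, κ (0, j + 1) = b := fun j => by simp [hκ]
  have hκq : ∀ i j, κ (i + 1, j + 1) = 1 := fun i j => by simp [hκ]
  have sx : ∀ f i, W.slowedMean κ f (i + 1, 0) = f (i + 1, 0) + (L * (f (i, 0) - f (i + 1, 0))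
      + rq * (f (i + 2, 0) - f (i + 1, 0)) + U * (f (i + 1, 1) - f (i + 1, 0))) / 2 := by
    intro f i
    obtain ⟨e1, e2, e3⟩ := hx (i + 1) (by omega)
    simp only [slowedMean, mean, hκx, e1, e2, e3, W.down_boundary, hrx, hL, hU,
      Nat.add_sub_cancel, zero_add, add_assoc, Nat.reduceAdd]
    field_simp
    linear_combination f (i + 1, 0) * hsx
  have sy : ∀ f j, W.slowedMean κ f (0, j + 1) = f (0, j + 1) + (D * (f (0, j) - f (0, j + 1))
      + uq * (f (0, j + 2) - f (0, j + 1)) + R * (f (1, j + 1) - f (0, j + 1))) / 2 := by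
    intro f j
    obtain ⟨e1, e2, e3⟩ := hy (j + 1) (by omega)
    simp only [slowedMean, mean, hκy, e1, e2, e3, W.left_boundary, huy, hD, hR,
      Nat.add_sub_cancel, zero_add, add_assoc, Nat.reduceAdd]
    field_simp
    linear_combination f (0, j + 1) * hsy
  have sq : ∀ f i j, W.slowedMean κ f (i + 1, j + 1) = f (i + 1, j + 1)
      + (lq * f (i, j + 1) + rq * f (i + 2, j + 1) + uq * f (i + 1, j + 2) + dq * f (i + 1, j)
        - f (i + 1, j + 1)) / 2 := by
    intro f i j
    obtain ⟨e1, e2, e3, e4⟩ := hq (i + 1) (j + 1) (by omega) (by omega)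
    simp only [slowedMean, mean, hκq, e1, e2, e3, e4, Nat.add_sub_cancel, add_assoc, Nat.reduceAdd]
    ring
  refine ⟨κ, max a b, fun p => ?_, fun p => ?_, fun f hf => ⟨fun i j hij => ?_, fun i j hij => ?_⟩⟩
  · rw [hκ]; dsimp only
    split_ifs <;> linarith
  · rw [hκ]; dsimp only
    have := le_max_left a b
    have := le_max_right a b
    split_ifs <;> linarith
  · have hm := hf.1
    rcases i with _ | i <;> rcases j with _ | j
    · exact absurd rfl hij
    · have s1 := sq f 0 j
      simp only [zero_add] at s1
      rw [zero_add, sy, s1]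
      -- The laziness supplies the `1` that absorbs the jump `R` off the axis; the surplus `D - dq`
      -- of downward moves on the axis is paid for in `k5` by monotonicity in the other coordinate.
      have k1 := mul_nonneg (by linarith : 0 ≤ 1 + rq - R) (sub_nonneg.2 (hm 0 (j + 1)))
      have k2 := mul_nonneg hr0.le (sub_nonneg.2 (hm 1 (j + 1)))
      have k3 := mul_nonneg hu0.le (sub_nonneg.2 (hm 0 (j + 2)))
      have k4 := mul_nonneg hd0.le (sub_nonneg.2 (hm 0 j))
      have k5 := mul_nonneg (sub_nonneg.2 hDd) (sub_nonneg.2 (hf.2 0 j))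
      simp only [zero_add, Nat.reduceAdd] at k1 k2 k3 k4 k5 ⊢
      have e : lq = 1 - rq - uq - dq := by linarith
      rw [e]
      linear_combination (k1 + k2 + k3 + k4 + k5) / 2
    · rw [sx, sx]
      have k1 := mul_nonneg (by linarith : 0 ≤ 2 - L - rq - U) (sub_nonneg.2 (hm (i + 1) 0))
      have k2 := mul_nonneg hr0.le (sub_nonneg.2 (hm (i + 2) 0))
      have k3 := mul_nonneg (hu0.le.trans hUu) (sub_nonneg.2 (hm (i + 1) 1))
      have k4 := mul_nonneg (hl0.le.trans hLl) (sub_nonneg.2 (hm i 0))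
      linear_combination (k1 + k2 + k3 + k4) / 2
    · rw [sq, sq]
      have k1 := sub_nonneg.2 (hm (i + 1) (j + 1))
      have k2 := mul_nonneg hr0.le (sub_nonneg.2 (hm (i + 2) (j + 1)))
      have k3 := mul_nonneg hu0.le (sub_nonneg.2 (hm (i + 1) (j + 2)))
      have k4 := mul_nonneg hl0.le (sub_nonneg.2 (hm i (j + 1)))
      have k5 := mul_nonneg hd0.le (sub_nonneg.2 (hm (i + 1) j))
      linear_combination (k1 + k2 + k3 + k4 + k5) / 2
  · have hm := hf.2
    rcases i with _ | i <;> rcases j with _ | j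
    · exact absurd rfl hij
    · rw [sy, sy]
      have k1 := mul_nonneg (by linarith : 0 ≤ 2 - R - uq - D) (sub_nonneg.2 (hm 0 (j + 1)))
      have k2 := mul_nonneg hu0.le (sub_nonneg.2 (hm 0 (j + 2)))
      have k3 := mul_nonneg (hr0.le.trans hRr) (sub_nonneg.2 (hm 1 (j + 1)))
      have k4 := mul_nonneg (hd0.le.trans hDd) (sub_nonneg.2 (hm 0 j))
      linear_combination (k1 + k2 + k3 + k4) / 2
    · have s1 := sq f i 0
      simp only [zero_add] at s1
      rw [zero_add, sx, s1]
      have k1 := mul_nonneg (by linarith : 0 ≤ 1 + uq - U) (sub_nonneg.2 (hm (i + 1) 0))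
      have k2 := mul_nonneg hu0.le (sub_nonneg.2 (hm (i + 1) 1))
      have k3 := mul_nonneg hr0.le (sub_nonneg.2 (hm (i + 2) 0))
      have k4 := mul_nonneg hl0.le (sub_nonneg.2 (hm i 0))
      have k5 := mul_nonneg (sub_nonneg.2 hLl) (sub_nonneg.2 (hf.1 i 0))
      simp only [zero_add, Nat.reduceAdd] at k1 k2 k3 k4 k5 ⊢
      have e : dq = 1 - rq - uq - lq := by linarith
      rw [e]
      linear_combination (k1 + k2 + k3 + k4 + k5) / 2
    · rw [sq, sq]
      have k1 := sub_nonneg.2 (hm (i + 1) (j + 1))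
      have k2 := mul_nonneg hr0.le (sub_nonneg.2 (hm (i + 2) (j + 1)))
      have k3 := mul_nonneg hu0.le (sub_nonneg.2 (hm (i + 1) (j + 2)))
      have k4 := mul_nonneg hl0.le (sub_nonneg.2 (hm i (j + 1)))
      have k5 := mul_nonneg hd0.le (sub_nonneg.2 (hm (i + 1) j))
      linear_combination (k1 + k2 + k3 + k4 + k5) / 2

/-- Iterating `T` from the subsolution `f` gives an increasing sequence bounded by the supersolution
`G`; coordinate monotonicity survives each iteration and the limit. -/
lemma exists_coordMono_fixedPoint {T : (ℕ × ℕ → ℝ) → ℕ × ℕ → ℝ}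
    (hmono : ∀ f g, (∀ p, f p ≤ g p) → ∀ p, T f p ≤ T g p)
    (hcont : ∀ (f : ℕ → ℕ × ℕ → ℝ) g, (∀ p, Tendsto (fun n => f n p) atTop (𝓝 (g p))) →
      ∀ p, Tendsto (fun n => T (f n) p) atTop (𝓝 (T g p)))
    {f G : ℕ × ℕ → ℝ} (hfG : ∀ p, f p ≤ G p) (hf : ∀ p, f p ≤ T f p) (hG : ∀ p, T G p ≤ G p)
    (hf1 : CoordMono f)
    (hT : ∀ g, (∀ p, f p ≤ g p) → (∀ p, g p ≤ G p) → CoordMono g → CoordMono (T g)) :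
    ∃ V, (∀ p, T V p = V p) ∧ (∀ p, f p ≤ V p) ∧ (∀ p, V p ≤ G p) ∧ CoordMono V := by
  have hsucc : ∀ n p, T^[n + 1] f p = T (T^[n] f) p := fun n p => by
    rw [Function.iterate_succ_apply']
  have hinc : ∀ p, Monotone fun n => T^[n] f p := by
    suffices ∀ n p, T^[n] f p ≤ T^[n + 1] f p from fun p => monotone_nat_of_le_succ (this · p)
    intro n
    induction n with
    | zero => exact hf
    | succ n ih =>
      intro p
      rw [hsucc, hsucc]
      exact hmono _ _ ih p
  have hle : ∀ n p, T^[n] f p ≤ G p := by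
    intro n
    induction n with
    | zero => exact hfG
    | succ n ih =>
      intro p
      rw [hsucc]
      exact (hmono _ _ ih p).trans (hG p)
  have hge : ∀ n p, f p ≤ T^[n] f p := fun n p => hinc p (Nat.zero_le n)
  have hcoord : ∀ n, CoordMono (T^[n] f) := by
    intro n
    induction n with
    | zero => exact hf1
    | succ n ih =>
      rw [Function.iterate_succ_apply']
      exact hT _ (hge n) (hle n) ih
  have hlim : ∀ p, Tendsto (fun n => T^[n] f p) atTop (𝓝 (⨆ n, T^[n] f p)) := fun p =>
    tendsto_atTop_ciSup (hinc p) ⟨G p, by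
      rintro _ ⟨n, rfl⟩
      exact hle n p⟩
  refine ⟨fun p => ⨆ n, T^[n] f p, fun p => ?_, fun p => ge_of_tendsto' (hlim p) (hge · p),
    fun p => le_of_tendsto' (hlim p) (hle · p),
    fun i j => le_of_tendsto_of_tendsto' (hlim _) (hlim _) fun n => (hcoord n).1 i j,
    fun i j => le_of_tendsto_of_tendsto' (hlim _) (hlim _) fun n => (hcoord n).2 i j⟩
  exact tendsto_nhds_unique ((hcont _ _ hlim p).congr fun n => (hsucc n p).symm)
    ((hlim p).comp (tendsto_add_atTop_nat 1))

/-! ### Monotone Lyapunov functions for `X` -/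

/-- `V` is the mean hitting time of `0` for the slowed walk. Positive recurrence supplies the finite
majorant `2 * K * S`, since slowing is by a factor at most `2 * K`. -/
theorem WeaklyInwardHomogeneous.exists_coordMono_foster {X : QuadrantWalk} (hX : X.Irreducible)
    (hXw : X.WeaklyInwardHomogeneous) (hpos : X.PositiveRecurrent) :
    ∃ V : ℕ × ℕ → ℝ, (∀ p, 0 ≤ V p) ∧ CoordMono V ∧ ∀ p, p ≠ 0 → X.mean V p ≤ V p - 1 := by
  obtain ⟨S, hS0, hS⟩ := hpos.exists_foster hX
  obtain ⟨κ, K, hκ1, hκK, hmono⟩ := hXw.exists_slowedMean_mono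
  have hK : 1 ≤ K := (hκ1 0).trans (hκK 0)
  have hκ0 : ∀ p, 0 < 2 * κ p := fun p => by linarith [hκ1 p]
  obtain ⟨V, hV, hV0, -, hVm⟩ := exists_coordMono_fixedPoint
    (T := fun f p => if p = 0 then 0 else 1 + X.slowedMean κ f p)
    (f := fun _ => 0) (G := fun p => 2 * K * S p)
    (fun f g h p => by
      split_ifs
      · exact le_rfl
      · linarith [X.slowedMean_mono hκ1 h p])
    (fun f g h p => by
      split_ifs
      exacts [tendsto_const_nhds, (X.tendsto_slowedMean κ h p).const_add 1])
    (fun p => mul_nonneg (by linarith) (hS0 p))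
    (fun p => by
      rw [slowedMean_const]
      split_ifs <;> norm_num)
    (fun p => by
      split_ifs with hp
      · exact mul_nonneg (by linarith) (hS0 p)
      · have h1 : 1 ≤ 2 * K / (2 * κ p) := by
          rw [one_le_div (hκ0 p)]; linarith [hκK p]
        rw [slowedMean, mean_const_mul, hS p hp]
        calc _ = 1 + 2 * K * S p - 2 * K / (2 * κ p) := by ring
          _ ≤ _ := by linarith)
    ⟨fun _ _ => le_rfl, fun _ _ => le_rfl⟩
    (fun g hg0 _ hg => by
      have h0 : ∀ p, 0 ≤ 1 + X.slowedMean κ g p := fun p => by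
        have := X.slowedMean_mono hκ1 hg0 p
        rw [slowedMean_const] at this
        linarith
      constructor
      · intro i j
        by_cases hij : (i, j) = (0, 0)
        · simpa [hij, Prod.ext_iff] using h0 (i + 1, j)
        · have := (hmono g hg).1 i j hij
          have h1 : (i, j) ≠ 0 := hij
          have h2 : (i + 1, j) ≠ (0 : ℕ × ℕ) := by simp [Prod.ext_iff]
          simp only [h1, h2, if_false]
          linarith
      · intro i j
        by_cases hij : (i, j) = (0, 0)
        · simpa [hij, Prod.ext_iff] using h0 (i, j + 1)
        · have := (hmono g hg).2 i j hij
          have h1 : (i, j) ≠ 0 := hij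
          have h2 : (i, j + 1) ≠ (0 : ℕ × ℕ) := by simp [Prod.ext_iff]
          simp only [h1, h2, if_false]
          linarith)
  refine ⟨V, hV0, hVm, fun p hp => ?_⟩
  have h := hV p
  simp only [hp, if_false, slowedMean] at h
  -- Undoing the slowing turns drift `-1` into `-(2 * κ p)`, which is at most `-1`.
  have h1 : (X.mean V p - V p) / (2 * κ p) = -1 := by linarith
  rw [div_eq_iff (hκ0 p).ne'] at h1
  linarith [hκ1 p]

/-- `V` is the probability of reaching level `N` before `0`, the same for the slowed walk. Pinning
`V` to its extreme values at `0` and beyond level `N` disposes of the comparisons there. -/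
theorem WeaklyInwardHomogeneous.exists_coordMono_harmonic {X : QuadrantWalk}
    (hXw : X.WeaklyInwardHomogeneous) (N : ℕ) :
    ∃ V : ℕ × ℕ → ℝ, (∀ p, 0 ≤ V p) ∧ (∀ p, V p ≤ 1) ∧ CoordMono V ∧
      (∀ p : ℕ × ℕ, N ≤ p.1 + p.2 → 1 ≤ V p) ∧ (0 < N → V 0 = 0) ∧
      ∀ p : ℕ × ℕ, p ≠ 0 → p.1 + p.2 < N → X.mean V p = V p := by
  obtain ⟨κ, K, hκ1, hκK, hmono⟩ := hXw.exists_slowedMean_mono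
  have hκ0 : ∀ p, 0 < 2 * κ p := fun p => by linarith [hκ1 p]
  have hnonneg : ∀ g : ℕ × ℕ → ℝ, (∀ p, 0 ≤ g p) → ∀ p, 0 ≤ X.slowedMean κ g p := by
    intro g hg p
    simpa only [slowedMean_const] using X.slowedMean_mono hκ1 hg p
  have hle1 : ∀ g : ℕ × ℕ → ℝ, (∀ p, g p ≤ 1) → ∀ p, X.slowedMean κ g p ≤ 1 := by
    intro g hg p
    simpa only [slowedMean_const] using X.slowedMean_mono hκ1 hg p
  have hind : ∀ p : ℕ × ℕ, (0 : ℝ) ≤ if N ≤ p.1 + p.2 then 1 else 0 := fun p => by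
    split_ifs <;> norm_num
  obtain ⟨V, hV, hV0, hV1, hVm⟩ := exists_coordMono_fixedPoint
    (T := fun f p => if N ≤ p.1 + p.2 then 1 else if p = 0 then 0 else X.slowedMean κ f p)
    (f := fun p => if N ≤ p.1 + p.2 then 1 else 0) (G := fun _ => 1)
    (fun f g h p => by
      split_ifs
      exacts [le_rfl, le_rfl, X.slowedMean_mono hκ1 h p])
    (fun f g h p => by
      split_ifs
      exacts [tendsto_const_nhds, tendsto_const_nhds, X.tendsto_slowedMean κ h p])
    (fun p => by split_ifs <;> norm_num)
    (fun p => by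
      split_ifs
      exacts [le_rfl, le_rfl, hnonneg _ hind p])
    (fun p => by
      rw [slowedMean_const]
      split_ifs <;> norm_num)
    (by
      constructor <;> intro i j <;> dsimp only <;> split_ifs <;> first | omega | norm_num)
    (fun g hg0 hg1 hg => by
      have h0 := hnonneg g fun p => (hind p).trans (hg0 p)
      have h1 := hle1 g hg1
      constructor
      · intro i j
        by_cases hN : N ≤ i + j
        · simp [hN, show N ≤ i + 1 + j by omega]
        by_cases hN' : N ≤ i + 1 + j
        · simp only [hN, hN', if_true, if_false]
          split_ifs
          exacts [zero_le_one, h1 _]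
        have h2 : (i + 1, j) ≠ (0 : ℕ × ℕ) := by simp [Prod.ext_iff]
        simp only [hN, hN', h2, if_false]
        split_ifs with hij
        exacts [h0 _, (hmono g hg).1 i j hij]
      · intro i j
        by_cases hN : N ≤ i + j
        · simp [hN, show N ≤ i + (j + 1) by omega]
        by_cases hN' : N ≤ i + (j + 1)
        · simp only [hN, hN', if_true, if_false]
          split_ifs
          exacts [zero_le_one, h1 _]
        have h2 : (i, j + 1) ≠ (0 : ℕ × ℕ) := by simp [Prod.ext_iff]
        simp only [hN, hN', h2, if_false]
        split_ifs with hij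
        exacts [h0 _, (hmono g hg).2 i j hij])
  refine ⟨V, fun p => (hind p).trans (hV0 p), hV1, hVm, fun p hp => ?_, fun hN => ?_,
    fun p hp hpN => ?_⟩
  · simpa [hp] using hV0 p
  · simpa [hN.ne'] using (hV 0).symm
  · have h := hV p
    simp only [hp, hpN.not_ge, if_false, slowedMean] at h
    have h1 : (X.mean V p - V p) / (2 * κ p) = 0 := by linarith
    rw [div_eq_iff (hκ0 p).ne'] at h1
    linarith

/-- A walk that does not avoid `0` cannot reach `{p | N ≤ p.1 + p.2}` in few steps. -/
lemma le_avoid_of_harmonic {W : QuadrantWalk} {V : ℕ × ℕ → ℝ} {N : ℕ} (hV1 : ∀ p, V p ≤ 1)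
    (hV0 : 0 < N → V 0 = 0)
    (hV : ∀ p : ℕ × ℕ, p ≠ 0 → p.1 + p.2 < N → W.mean V p = V p) (n : ℕ) (p : ℕ × ℕ)
    (hp : p.1 + p.2 + n < N) : V p ≤ if p = 0 then 0 else W.avoid 0 n p := by
  induction n generalizing p with
  | zero =>
    split_ifs with h
    · rw [h, hV0 (by omega)]
    · exact hV1 p
  | succ n ih =>
    split_ifs with h
    · rw [h, hV0 (by omega)]
    rw [← hV p h (by omega)]
    obtain ⟨i, j⟩ := p
    simp only [avoid, mean]
    have k1 := W.right_nonneg (i, j)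
    have k2 := W.left_nonneg (i, j)
    have k3 := W.up_nonneg (i, j)
    have k4 := W.down_nonneg (i, j)
    dsimp only at hp
    -- A move raises `p.1 + p.2` by at most one.
    gcongr <;> exact ih _ (by dsimp only; omega)

end QuadrantWalk

/-! ### Comparison of `Y` with `X` -/

theorem mainTheorem2 (X Y : QuadrantWalk)
    (hX : X.Irreducible) (hXw : X.WeaklyInwardHomogeneous)
    (hY : Y.Irreducible) (hYX : Y.Preceq X) :
    (X.Recurrent → Y.Recurrent) ∧ (X.PositiveRecurrent → Y.PositiveRecurrent) := by
  constructor
  · intro hrec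
    choose V hV0 hV1 hVm hVN hV00 hVh using hXw.exists_coordMono_harmonic
    refine hY.recurrent_of_superharmonic V hV0 hVN
      (fun N p hp hpN => (hYX.mean_le (hVm N) p).trans_eq (hVh N p hp hpN)) fun p => ?_
    -- From `p`, level `N` is out of reach within `N - (p.1 + p.2 + 1)` steps, so `V N p` is at most
    -- the probability of avoiding `0` that long.
    have hlim := (hrec.tendsto_avoid hX 0 p).comp (tendsto_sub_atTop_nat (p.1 + p.2 + 1))
    refine tendsto_of_tendsto_of_tendsto_of_le_of_le' tendsto_const_nhds hlim
      (.of_forall fun N => hV0 N p) ?_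
    filter_upwards [eventually_ge_atTop (p.1 + p.2 + 1)] with N hN
    refine (QuadrantWalk.le_avoid_of_harmonic (hV1 N) (hV00 N) (hVh N) (N - (p.1 + p.2 + 1)) p
      (by omega)).trans ?_
    split_ifs
    exacts [X.avoid_nonneg _ _ _, le_rfl]
  · intro hpos
    obtain ⟨V, hV0, hVm, hV⟩ := hXw.exists_coordMono_foster hX hpos
    exact hY.positiveRecurrent_of_foster hV0 fun p hp => (hYX.mean_le hVm p).trans (hV p hp)
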